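/- Let $P_n^{\mathrm{Poi}}$ be the path $v_1v_2\cdots v_n$ whose vertices carry independent initial weights, each Poisson distributed with mean $1$. In a weighted graph, an acquisition move takes a vertex $v$ of positive weight and an adjacent vertex $u$ whose current weight is at least that of $v$, and transfers the whole weight of $v$ to $u$. When no acquisition move remains, the set of vertices of non-zero weight is called a residual set; the total acquisition number is the minimum cardinality of a residual set that can be reached from the initial weights. Let $A_t(P_n^{\mathrm{Poi}})$ be the total acquisition number of $P_n^{\mathrm{Poi}}$. Then $$0.29523\,n \le E\bigl(A_t(P_n^{\mathrm{Poi}})\bigr)\quad\text{for every } n\ge 1,$$ and $$E\bigl(A_t(P_n^{\mathrm{Poi}})\bigr)\le 0.29576\,n\quad\text{for all sufficiently large } n.$$ -/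

import Mathlib

open MeasureTheory ProbabilityTheory Filter

namespace Acquisition

section

variable {V : Type*} [Fintype V] [DecidableEq V]

/-- One acquisition move on the weighted graph `(G, w)`, with result `w'`: a vertex `v` of positive
weight transfers its whole weight to a neighbour `u` whose current weight is at least that of `v`. -/
def Move (G : SimpleGraph V) (w w' : V → ℕ) : Prop :=
  ∃ v u : V, G.Adj v u ∧ 0 < w v ∧ w v ≤ w u ∧
    w' = Function.update (Function.update w u (w u + w v)) v 0

/-- The set of vertices of non-zero weight. -/
def weightSupport (w : V → ℕ) : Finset V := Finset.univ.filter fun v => w v ≠ 0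

/-- `S` is a residual set of the weighted graph `(G, w)`: some finite sequence of acquisition moves
from `w` ends in a weighting that admits no further move and whose vertices of non-zero weight are
exactly those of `S`. -/
def IsResidualSet (G : SimpleGraph V) (w : V → ℕ) (S : Finset V) : Prop :=
  ∃ w' : V → ℕ, Relation.ReflTransGen (Move G) w w' ∧ (∀ w'' : V → ℕ, ¬ Move G w' w'') ∧
    weightSupport w' = S

/-- The total acquisition number of the weighted graph `(G, w)`: the minimum cardinality of a
residual set. -/
noncomputable def acquisitionNumber (G : SimpleGraph V) (w : V → ℕ) : ℕ :=
  sInf {k : ℕ | ∃ S : Finset V, IsResidualSet G w S ∧ S.card = k}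

/-- A move strictly decreases the number of vertices of non-zero weight. -/
theorem Move.card_lt {G : SimpleGraph V} {w w' : V → ℕ} (h : Move G w w') :
    (weightSupport w').card < (weightSupport w).card := by
  obtain ⟨v, u, hvu, hv, hle, rfl⟩ := h
  apply Finset.card_lt_card
  rw [Finset.ssubset_iff_of_subset]
  · exact ⟨v, by simp [weightSupport]; omega, by simp [weightSupport]⟩
  · intro x hx
    simp only [weightSupport, Finset.mem_filter, Finset.mem_univ, true_and,
      Function.update_apply] at hx ⊢
    split_ifs at hx with h1 h2
    · exact absurd rfl hx
    · subst h2; omega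
    · exact hx

/-- Residual sets exist, so the minimum in the definition of `acquisitionNumber` is attained. -/
theorem exists_isResidualSet (G : SimpleGraph V) (w : V → ℕ) : ∃ S, IsResidualSet G w S := by
  induction hn : (weightSupport w).card using Nat.strong_induction_on generalizing w with
  | _ n ih =>
    by_cases h : ∃ w', Move G w w'
    · obtain ⟨w', hw'⟩ := h
      obtain ⟨S, w₁, h1, h2, h3⟩ := ih _ (hn ▸ hw'.card_lt) w' rfl
      exact ⟨S, w₁, Relation.ReflTransGen.head hw' h1, h2, h3⟩
    · push Not at h
      exact ⟨_, w, Relation.ReflTransGen.refl, h, rfl⟩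

theorem acquisitionNumber_le_card (G : SimpleGraph V) (w : V → ℕ) :
    acquisitionNumber G w ≤ Fintype.card V := by
  obtain ⟨S, hS⟩ := exists_isResidualSet G w
  have h : acquisitionNumber G w ≤ S.card := Nat.sInf_le ⟨S, hS, rfl⟩
  exact h.trans (Finset.card_le_univ S)

end

/-- The law of the weights of `P_n^Poi`: independent Poisson variables of mean `1`, one for each of
the `n` vertices. -/
noncomputable def poissonWeights (n : ℕ) : Measure (Fin n → ℕ) :=
  Measure.pi fun _ : Fin n => poissonMeasure 1

/-- The expected total acquisition number of the Poisson-weighted path on `n` vertices. -/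
noncomputable def expectedPathAcquisition (n : ℕ) : ℝ :=
  ∫ w, (acquisitionNumber (SimpleGraph.pathGraph n) w : ℝ) ∂(poissonWeights n)

/-- The expectation is that of an integrable random variable. -/
theorem integrable_acquisitionNumber (n : ℕ) :
    Integrable (fun w => (acquisitionNumber (SimpleGraph.pathGraph n) w : ℝ))
      (poissonWeights n) := by
  have : IsProbabilityMeasure (poissonWeights n) := by
    unfold poissonWeights; infer_instance
  refine Integrable.of_bound (C := (n : ℝ)) ?_ ?_
  · exact (measurable_of_countable _).aestronglyMeasurable
  · refine Eventually.of_forall fun w => ?_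
    have h := acquisitionNumber_le_card (SimpleGraph.pathGraph n) w
    rw [Fintype.card_fin] at h
    rw [Real.norm_of_nonneg (by positivity)]
    exact_mod_cast h

end Acquisition

/-! The weights are split greedily from left to right into blocks, each of which collapses to one
vertex. In an ascending block everything is pushed right, which needs `S ≤ x`. After a descent the
tail is pulled left: if `t` is gathered behind an absorbed `x`, one needs `t ≤ x` and, when the
earlier capacity was `m`, also `x + t ≤ m`, whence `min (m - x) x`. At the peak only `t ≤ x`
matters, since of the piles `S` and `x + t` the smaller moves onto the larger.

The number of blocks is the acquisition number (`acquisitionNumber_pathGraph`). No move decreases it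
and it is at most the number of positive weights, so residual sets are at least this large; while it
is strictly smaller, some move does not increase it (`exists_listMove`), so equality is reached.

The states thus form a Markov chain with cost `opens`. An explicit approximate solution `h` of its
Poisson equation, with `c + h s ≤ E[opens + h(next)] ≤ c' + h s`, bounds the expectation by
induction on `n`. -/

namespace Acquisition

/-- The states of the greedy left-to-right decomposition of a weighted path. In `asc S` the current
block has total weight `S`, all of which has been gathered at its last vertex; in `desc m` the
current block is descending and can absorb a further vertex of weight at most `m`. -/
inductive GreedyState : Type
  | asc (S : ℕ)
  | desc (m : ℕ)

/-! ### The greedy automaton and its monotonicity -/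

namespace GreedyState

/-- The number of blocks opened when a vertex of weight `x` is read. -/
def opens : GreedyState → ℕ → ℕ
  | asc _, _ => 0
  | desc m, x => if x ≤ m then 0 else 1

/-- The state after reading a vertex of weight `x`. -/
def next : GreedyState → ℕ → GreedyState
  | asc S, x => if S ≤ x then asc (S + x) else desc x
  | desc m, x => if x ≤ m then desc (min (m - x) x) else asc x

/-- The number of blocks opened while a list of weights is read. -/
def count : GreedyState → List ℕ → ℕ
  | _, [] => 0
  | s, x :: l => s.opens x + (s.next x).count l

/-- `s.Dom t`: whatever can be absorbed from `t` can be absorbed from `s`. -/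
def Dom : GreedyState → GreedyState → Prop
  | asc S, asc T => S ≤ T
  | asc S, desc m => m ≤ S
  | desc m, desc k => k ≤ m
  | desc _, asc _ => False

@[simp] theorem count_nil (s : GreedyState) : s.count [] = 0 := rfl

theorem count_cons (s : GreedyState) (x : ℕ) (l : List ℕ) :
    s.count (x :: l) = s.opens x + (s.next x).count l := rfl

theorem opens_le_one (s : GreedyState) (x : ℕ) : s.opens x ≤ 1 := by
  cases s <;> simp only [opens] <;> (try split_ifs) <;> omega

theorem dom_desc_zero (s : GreedyState) : s.Dom (desc 0) := by
  cases s <;> simp [Dom]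

/-- If `s` opens a block at `x` and `t` does not, `s` is not behind `t` afterwards. -/
theorem dom_next_of_opens {s t : GreedyState} {x : ℕ} (h : t.opens x < s.opens x) :
    (s.next x).Dom (t.next x) := by
  cases s <;> cases t <;> simp only [opens, next] at h ⊢ <;> split_ifs at h ⊢ <;>
    simp only [Dom] <;> omega

theorem dom_step {s t : GreedyState} (h : s.Dom t) (x : ℕ) :
    (s.opens x ≤ t.opens x ∧ (s.next x).Dom (t.next x)) ∨ s.opens x < t.opens x := by
  cases s <;> cases t <;> simp only [Dom] at h <;> simp only [opens, next] <;> split_ifs <;>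
    simp only [Dom] <;> omega

/-- The two claims need each other: when dominance is lost, `s` has just saved a block, which pays
for the difference of at most one; when `s` opens an extra block, it dominates from then on. -/
theorem count_le (l : List ℕ) :
    (∀ s t : GreedyState, s.Dom t → s.count l ≤ t.count l) ∧
      ∀ s t : GreedyState, s.count l ≤ t.count l + 1 := by
  induction l with
  | nil => simp
  | cons x l ih =>
    constructor
    · intro s t h
      rw [count_cons, count_cons]
      rcases dom_step h x with ⟨h1, h2⟩ | h1
      · exact add_le_add h1 (ih.1 _ _ h2)
      · have := ih.2 (s.next x) (t.next x)
        omega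
    · intro s t
      rw [count_cons, count_cons]
      have h1 := opens_le_one s x
      rcases lt_or_ge (t.opens x) (s.opens x) with h | h
      · have := ih.1 _ _ (dom_next_of_opens h)
        omega
      · have := ih.2 (s.next x) (t.next x)
        omega

theorem count_le_of_dom {s t : GreedyState} (h : s.Dom t) (l : List ℕ) :
    s.count l ≤ t.count l := (count_le l).1 s t h

theorem count_le_add_one (s t : GreedyState) (l : List ℕ) : s.count l ≤ t.count l + 1 :=
  (count_le l).2 s t

theorem count_le_length (s : GreedyState) (l : List ℕ) : s.count l ≤ l.length := by
  induction l generalizing s with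
  | nil => simp
  | cons x l ih =>
    have := ih (s.next x)
    have := opens_le_one s x
    rw [count_cons, List.length_cons]
    omega

theorem count_le_countP (s : GreedyState) (l : List ℕ) : s.count l ≤ l.countP (0 < ·) := by
  induction l generalizing s with
  | nil => simp
  | cons x l ih =>
    have := ih (s.next x)
    have := opens_le_one s x
    rw [count_cons, List.countP_cons]
    rcases Nat.eq_zero_or_pos x with rfl | hx
    · have : s.opens 0 = 0 := by cases s <;> simp [opens]
      simp
      omega
    · simp [hx]
      omega

theorem next_zero_dom (s : GreedyState) (l : List ℕ) :
    (s.next 0).count l ≤ (desc 0).count l := count_le_of_dom (dom_desc_zero _) l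

end GreedyState

/-! ### Moves against the greedy count -/

/-- An acquisition move on a path, in terms of the list of its weights. -/
def ListMove (l l' : List ℕ) : Prop :=
  ∃ p a b q, l = p ++ a :: b :: q ∧
    ((0 < a ∧ a ≤ b ∧ l' = p ++ 0 :: (a + b) :: q) ∨
      (0 < b ∧ b ≤ a ∧ l' = p ++ (a + b) :: 0 :: q))

theorem ListMove.cons {l l' : List ℕ} (h : ListMove l l') (x : ℕ) :
    ListMove (x :: l) (x :: l') := by
  obtain ⟨p, a, b, q, rfl, h⟩ := h
  exact ⟨x :: p, a, b, q, rfl, by simpa using h⟩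

namespace GreedyState

/-- Unless `s = asc 0`, the new zero closes the current block, so `a + b` opens one. Reading `a, b`
opens at most one, since a block opened at `a` ascends through `b`. -/
theorem count_move_right (s : GreedyState) {a b : ℕ} (h : a ≤ b) (h0 : 0 < a) (q : List ℕ) :
    s.count (a :: b :: q) ≤ s.count (0 :: (a + b) :: q) := by
  have hz : s.next 0 = desc 0 ∨ s = asc 0 := by
    cases s with
    | asc S => by_cases hS : S = 0 <;> simp [next, hS]
    | desc m => simp [next]
  have key : ∀ t : GreedyState, t.count (a :: b :: q) ≤ 1 + (asc (a + b)).count q := by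
    intro t
    have h1 := fun u => count_le_add_one u (asc (a + b)) q
    have h2 := fun S (hS : S ≤ a + b) => count_le_of_dom (s := asc S) (t := asc (a + b)) hS q
    have h3 := h2 b (by omega)
    simp only [count_cons]
    cases t with
    | asc S =>
      simp only [opens, next]
      split_ifs <;> dsimp only <;> split_ifs <;>
        first
        | (have := h1 (asc (S + a + b)); omega)
        | (have := h1 (desc b); omega)
        | (have := h1 (desc (min (a - b) b)); omega)
    | desc m =>
      simp only [opens, next]
      split_ifs <;> dsimp only <;> split_ifs <;>
        first
        | omega
        | (have := h1 (desc (min (min (m - a) a - b) b)); omega)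
  have hR : (desc 0).count ((a + b) :: q) = 1 + (asc (a + b)).count q := by
    have h' : ¬ (a + b ≤ 0) := by omega
    simp only [count_cons, opens, next, if_neg h']
  rcases hz with hz | rfl
  · have : s.opens 0 = 0 := by cases s <;> simp [opens]
    rw [count_cons s 0, hz, hR, this]
    have := key s
    omega
  · have h1 : ¬ (b < a) := by omega
    simp [count_cons, opens, next, h]

/-- After the move the zero leaves the dominated state `desc 0`, unless `a = b = 0`. -/
theorem count_move_left (s : GreedyState) {a b : ℕ} (h : b ≤ a) (q : List ℕ) :
    s.count (a :: b :: q) ≤ s.count ((a + b) :: 0 :: q) := by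
  have h1 := count_le_of_dom (dom_desc_zero ((s.next a).next b)) q
  have h2 : s.opens a + (s.next a).opens b ≤ s.opens (a + b) + (s.next (a + b)).opens 0 := by
    cases s <;> simp only [opens, next] <;> split_ifs <;> dsimp only <;>
      (try split_ifs) <;> omega
  by_cases h3 : (s.next (a + b)).next 0 = desc 0
  · simp only [count_cons, h3]
    omega
  · have h4 : a = 0 ∧ b = 0 := by
      cases s <;> simp only [next] at h3 <;> split_ifs at h3 <;> dsimp only at h3 <;>
        (try split_ifs at h3) <;> first | (simp at h3; done) | omega
    obtain ⟨rfl, rfl⟩ := h4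
    rfl

theorem count_le_of_listMove (s : GreedyState) {l l' : List ℕ} (h : ListMove l l') :
    s.count l ≤ s.count l' := by
  obtain ⟨p, a, b, q, rfl, h⟩ := h
  induction p generalizing s l' with
  | nil =>
    rcases h with ⟨h0, h, rfl⟩ | ⟨-, h, rfl⟩
    · exact count_move_right s h h0 q
    · exact count_move_left s h q
  | cons x p ih =>
    rcases h with ⟨h0, h, rfl⟩ | ⟨h0, h, rfl⟩
    · exact add_le_add le_rfl (ih _ (Or.inl ⟨h0, h, rfl⟩))
    · exact add_le_add le_rfl (ih _ (Or.inr ⟨h0, h, rfl⟩))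

/-- A vertex absorbed into a descending block can be merged with what follows it, unless nothing
that follows is absorbed. -/
theorem exists_listMove_of_absorbed (s : GreedyState) (y m : ℕ) (l : List ℕ)
    (h0 : s.opens y = 0) (hn : s.next y = desc m) :
    (desc m).count l = (desc 0).count l ∨
      ∃ l', ListMove (y :: l) l' ∧ s.count l' ≤ s.count (y :: l) := by
  induction l generalizing s y m with
  | nil => simp
  | cons z l ih =>
    have hmy : m ≤ y := by
      cases s <;> simp only [next] at hn <;> split_ifs at hn <;> cases hn <;> omega
    rcases Nat.eq_zero_or_pos z with rfl | hz
    · left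
      simp [count_cons, opens, next]
    rcases lt_or_ge m z with hmz | hmz
    · left
      simp [count_cons, opens, next, hmz.not_ge, hz.ne']
    right
    have hz0 : (desc m).opens z = 0 := by simp [opens, hmz]
    have hz1 : (desc m).next z = desc (min (m - z) z) := by simp [next, hmz]
    rcases ih (desc m) z _ hz0 hz1 with h | ⟨l', hl', hc⟩
    -- Here `z` ends the absorbed run, so resetting to `desc 0` after it is free, and `z ≤ m` lets
    -- `y + z` still be absorbed.
    · refine ⟨(y + z) :: 0 :: l, ⟨[], y, z, l, rfl, Or.inr ⟨hz, by omega, rfl⟩⟩, ?_⟩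
      have hyz : s.opens (y + z) = 0 := by
        cases s with
        | asc S => rfl
        | desc k =>
          simp only [next] at hn
          split_ifs at hn
          cases hn
          simp only [opens]
          rw [if_pos (by omega)]
      have e : ∀ u : GreedyState, u.opens 0 = 0 := by rintro (_ | _) <;> simp [opens]
      rw [count_cons s y, hn, count_cons (desc m), hz1, h, h0, hz0, count_cons, hyz, count_cons, e]
      have := next_zero_dom (s.next (y + z)) l
      omega
    · exact ⟨y :: l', hl'.cons y, by rw [count_cons, count_cons s y, hn]; omega⟩

/-- Some block has two positive vertices: push right on an ascent, otherwise fold the end of the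
descending run leftwards. -/
theorem exists_listMove : ∀ l : List ℕ, (desc 0).count l < l.countP (0 < ·) →
    ∃ l', ListMove l l' ∧ (desc 0).count l' ≤ (desc 0).count l
  | [], h => by simp at h
  | 0 :: l, h => by
    have e : ∀ l, (desc 0).count (0 :: l) = (desc 0).count l := by
      intro l; simp [count_cons, opens, next]
    rw [e] at h
    obtain ⟨l', h1, h2⟩ := exists_listMove l (by simpa using h)
    exact ⟨0 :: l', h1.cons 0, by rwa [e, e]⟩
  | [x + 1], h => by simp [count_cons, opens] at h
  | (x + 1) :: y :: l, h => by
    have e : ∀ l, (desc 0).count ((x + 1) :: l) = 1 + (asc (x + 1)).count l := by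
      intro l; simp [count_cons, opens, next]
    rcases le_or_gt (x + 1) y with hy | hy
    · refine ⟨0 :: (x + 1 + y) :: l, ⟨[], x + 1, y, l, rfl, Or.inl ⟨by omega, hy, rfl⟩⟩, ?_⟩
      rw [e]
      simp [count_cons, opens, next, hy]
    have e1 : ∀ l, (asc (x + 1)).count (y :: l) = (desc y).count l := by
      intro l; simp [count_cons, opens, next, hy.not_ge]
    rcases Nat.eq_zero_or_pos y with rfl | hy0
    · rw [e, e1] at h
      obtain ⟨l', h1, h2⟩ := exists_listMove l (by simp at h; omega)
      exact ⟨(x + 1) :: 0 :: l', (h1.cons 0).cons _, by rw [e, e, e1, e1]; omega⟩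
    rcases exists_listMove_of_absorbed (asc (x + 1)) y y l rfl (by simp [next, hy.not_ge])
      with h' | ⟨l', h1, h2⟩
    · refine ⟨(x + 1 + y) :: 0 :: l,
        ⟨[], x + 1, y, l, rfl, Or.inr ⟨hy0, by omega, rfl⟩⟩, ?_⟩
      rw [e, e1, h']
      simp [count_cons, opens, next]
    · exact ⟨(x + 1) :: l', h1.cons _, by rw [e, e]; omega⟩

end GreedyState

/-! ### From lists to the path graph -/

theorem ofFn_update {n : ℕ} (w : Fin n → ℕ) (i : Fin n) (x : ℕ) :
    List.ofFn (Function.update w i x) = (List.ofFn w).set i x := by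
  apply List.ext_getElem
  · simp
  · intro k h1 h2
    simp only [List.getElem_ofFn, List.getElem_set, Function.update_apply, Fin.ext_iff]
    split_ifs <;> first | rfl | omega

theorem ofFn_eq_append {n : ℕ} (w : Fin n → ℕ) {i : ℕ} (h : i + 1 < n) :
    ∃ p q, p.length = i ∧ List.ofFn w = p ++ w ⟨i, by omega⟩ :: w ⟨i + 1, h⟩ :: q := by
  refine ⟨(List.ofFn w).take i, (List.ofFn w).drop (i + 2), by simp; omega, ?_⟩
  conv_lhs => rw [← List.take_append_drop i (List.ofFn w)]
  rw [List.drop_eq_getElem_cons (by simp; omega), List.drop_eq_getElem_cons (by simp; omega)]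
  simp

theorem Move.listMove {n : ℕ} {w w' : Fin n → ℕ} (h : Move (SimpleGraph.pathGraph n) w w') :
    ListMove (List.ofFn w) (List.ofFn w') := by
  obtain ⟨⟨v, hv⟩, ⟨u, hu⟩, hvu, h0, hle, rfl⟩ := h
  rw [ofFn_update, ofFn_update]
  rw [SimpleGraph.pathGraph_adj] at hvu
  simp only at hvu
  rcases hvu with rfl | rfl
  · obtain ⟨p, q, rfl, hpq⟩ := ofFn_eq_append w hu
    refine ⟨p, _, _, q, hpq, Or.inl ⟨h0, hle, ?_⟩⟩
    rw [add_comm (w ⟨p.length, hv⟩), hpq]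
    simp
  · obtain ⟨p, q, rfl, hpq⟩ := ofFn_eq_append w hv
    refine ⟨p, _, _, q, hpq, Or.inr ⟨h0, hle, ?_⟩⟩
    rw [hpq]
    simp

theorem ListMove.exists_move {n : ℕ} {w : Fin n → ℕ} {l : List ℕ}
    (h : ListMove (List.ofFn w) l) :
    ∃ w', Move (SimpleGraph.pathGraph n) w w' ∧ List.ofFn w' = l := by
  obtain ⟨p, a, b, q, hl, h⟩ := h
  have hlen : p.length + 1 < n := by
    have := congrArg List.length hl
    simp at this
    omega
  have ha : w ⟨p.length, by omega⟩ = a := by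
    have : (List.ofFn w)[p.length]? = some a := by rw [hl]; simp
    simpa [List.getElem?_ofFn, show p.length < n by omega] using this
  have hb : w ⟨p.length + 1, hlen⟩ = b := by
    have : (List.ofFn w)[p.length + 1]? = some b := by rw [hl]; simp
    simpa [List.getElem?_ofFn, hlen] using this
  rcases h with ⟨h0, hle, rfl⟩ | ⟨h0, hle, rfl⟩
  · refine ⟨_, ⟨⟨p.length, by omega⟩, ⟨p.length + 1, hlen⟩, ?_, ?_, ?_, rfl⟩, ?_⟩
    · simp [SimpleGraph.pathGraph_adj]
    · rwa [ha]
    · rwa [ha, hb]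
    · rw [ofFn_update, ofFn_update, ha, hb, hl]
      simp [add_comm]
  · refine ⟨_, ⟨⟨p.length + 1, hlen⟩, ⟨p.length, by omega⟩, ?_, ?_, ?_, rfl⟩, ?_⟩
    · simp [SimpleGraph.pathGraph_adj]
    · rwa [hb]
    · rwa [ha, hb]
    · rw [ofFn_update, ofFn_update, ha, hb, hl]
      simp

theorem card_weightSupport_eq_countP {n : ℕ} (w : Fin n → ℕ) :
    (weightSupport w).card = (List.ofFn w).countP (0 < ·) := by
  unfold weightSupport
  induction n with
  | zero => simp
  | succ n ih =>
    rw [Fin.card_filter_univ_succ, List.ofFn_succ, List.countP_cons, ← ih fun i => w i.succ]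
    rcases Nat.eq_zero_or_pos (w 0) with h | h
    · simp [h]
    · simp [h, h.ne']

open GreedyState

theorem exists_isResidualSet_card_le {n : ℕ} (w : Fin n → ℕ) :
    ∃ S, IsResidualSet (SimpleGraph.pathGraph n) w S ∧
      S.card ≤ (desc 0).count (List.ofFn w) := by
  induction hn : (weightSupport w).card using Nat.strong_induction_on generalizing w with
  | _ k ih =>
    by_cases h : (desc 0).count (List.ofFn w) < (List.ofFn w).countP (0 < ·)
    · obtain ⟨l, hl, hc⟩ := exists_listMove _ h
      obtain ⟨w', hw', rfl⟩ := hl.exists_move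
      obtain ⟨S, ⟨w₁, h1, h2, h3⟩, hS⟩ := ih _ (hn ▸ hw'.card_lt) w' rfl
      exact ⟨S, ⟨w₁, Relation.ReflTransGen.head hw' h1, h2, h3⟩, hS.trans hc⟩
    -- No move remains: it would push the number of positive weights below the count.
    · rw [← card_weightSupport_eq_countP] at h
      refine ⟨weightSupport w, ⟨w, Relation.ReflTransGen.refl, fun w' hw' => h ?_, rfl⟩,
        not_lt.1 h⟩
      calc (desc 0).count (List.ofFn w) ≤ (desc 0).count (List.ofFn w') :=
            count_le_of_listMove _ hw'.listMove
        _ ≤ (List.ofFn w').countP (0 < ·) := count_le_countP _ _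
        _ = (weightSupport w').card := (card_weightSupport_eq_countP w').symm
        _ < (weightSupport w).card := hw'.card_lt

theorem acquisitionNumber_pathGraph {n : ℕ} (w : Fin n → ℕ) :
    acquisitionNumber (SimpleGraph.pathGraph n) w = (desc 0).count (List.ofFn w) := by
  obtain ⟨S, hS, hc⟩ := exists_isResidualSet_card_le w
  refine le_antisymm (le_trans (Nat.sInf_le ⟨S, hS, rfl⟩) hc) ?_
  refine le_csInf ⟨S.card, S, hS, rfl⟩ ?_
  rintro _ ⟨T, ⟨w', hw', -, rfl⟩, rfl⟩
  rw [card_weightSupport_eq_countP]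
  refine le_trans ?_ (count_le_countP (desc 0) _)
  induction hw' with
  | refl => exact le_rfl
  | tail _ h ih => exact ih.trans (count_le_of_listMove _ h.listMove)

/-! ### Expected cost of the Markov chain -/

instance isProbabilityMeasure_poissonWeights (n : ℕ) :
    IsProbabilityMeasure (poissonWeights n) := by
  unfold poissonWeights; infer_instance

theorem integrable_of_abs_le {α : Type*} [MeasurableSpace α] [Countable α]
    [MeasurableSingletonClass α] {μ : Measure α} [IsFiniteMeasure μ] {f : α → ℝ} (C : ℝ)
    (h : ∀ x, |f x| ≤ C) : Integrable f μ :=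
  Integrable.of_bound (measurable_of_countable _).aestronglyMeasurable C (Eventually.of_forall h)

/-- The expected number of blocks opened from the state `s` on a path of `n` vertices. -/
noncomputable def expectedCount (n : ℕ) (s : GreedyState) : ℝ :=
  ∫ w, (s.count (List.ofFn w) : ℝ) ∂(poissonWeights n)

theorem abs_count_ofFn_le {n : ℕ} (s : GreedyState) (w : Fin n → ℕ) :
    |(s.count (List.ofFn w) : ℝ)| ≤ n := by
  rw [abs_of_nonneg (by positivity)]
  have := count_le_length s (List.ofFn w)
  rw [List.length_ofFn] at this
  exact_mod_cast this

theorem abs_expectedCount_le (n : ℕ) (s : GreedyState) : |expectedCount n s| ≤ n := by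
  have := norm_integral_le_of_norm_le_const (μ := poissonWeights n)
    (f := fun w => (s.count (List.ofFn w) : ℝ)) (Eventually.of_forall (abs_count_ofFn_le s))
  simpa [expectedCount] using this

theorem expectedCount_zero (s : GreedyState) : expectedCount 0 s = 0 := by
  simp [expectedCount]

theorem expectedCount_succ (n : ℕ) (s : GreedyState) :
    expectedCount (n + 1) s =
      ∫ x, ((s.opens x : ℝ) + expectedCount n (s.next x)) ∂(poissonMeasure 1) := by
  have hmp := (measurePreserving_piFinSuccAbove
    (fun _ : Fin (n + 1) => poissonMeasure 1) 0).symm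
  unfold expectedCount poissonWeights
  rw [← hmp.integral_comp (MeasurableEquiv.measurableEmbedding _), integral_prod]
  · refine integral_congr_ae (Eventually.of_forall fun x => ?_)
    simp only [MeasurableEquiv.piFinSuccAbove_symm_apply, Fin.insertNthEquiv_apply,
      Fin.insertNth_zero', List.ofFn_succ, Fin.cons_zero, Fin.cons_succ, count_cons, Nat.cast_add]
    rw [integral_add (integrable_const _)
      (integrable_of_abs_le (n : ℝ) (abs_count_ofFn_le (s.next x)))]
    simp
  · exact integrable_of_abs_le ((n + 1 : ℕ) : ℝ) fun x => abs_count_ofFn_le s _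

/-- Truncation of a Poisson expectation. -/
theorem le_integral_poissonMeasure_one {f : ℕ → ℝ} (hf : Integrable f (poissonMeasure 1))
    {m : ℝ} (hm : ∀ x, m ≤ f x) (k : ℕ) :
    m + Real.exp (-1) * ∑ x ∈ Finset.range k, (f x - m) / (x.factorial : ℝ) ≤
      ∫ x, f x ∂(poissonMeasure 1) := by
  have h := hasSum_integral_poissonMeasure (hf.sub (integrable_const m))
  have h1 := sum_le_hasSum (Finset.range k) (fun x _ => smul_nonneg (by positivity)
    (sub_nonneg.2 (hm x))) h
  rw [integral_sub' hf (integrable_const m)] at h1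
  simp only [integral_const, probReal_univ, smul_eq_mul, one_mul] at h1
  rw [Finset.mul_sum]
  refine le_trans (add_le_add le_rfl (le_trans (le_of_eq ?_) h1)) (le_of_eq (by ring))
  refine Finset.sum_congr rfl fun x _ => ?_
  simp
  ring

/-! ### Numerical solution of the Poisson equation -/

/-- Approximate relative values of the states, in units of `10⁻⁵`. -/
def potential : GreedyState → ℤ
  | asc S => [-100000, -58446, -46780, -44348, -43921, -43885].getD S (-43882)
  | desc m => [0, -15287, -30700, -36924, -41556, -42907, -43601, -43755, -43855,
      -43873].getD m (-43882)

/-- The cost of a step, corrected by the potential of its target. -/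
def stepValue (s : GreedyState) (x : ℕ) : ℤ := 100000 * s.opens x + potential (s.next x)

theorem getD_mem_Icc {l : List ℤ} {d a b : ℤ} (h : ∀ x ∈ d :: l, a ≤ x ∧ x ≤ b) (k : ℕ) :
    a ≤ l.getD k d ∧ l.getD k d ≤ b := by
  rcases lt_or_ge k l.length with hk | hk
  · rw [List.getD_eq_getElem _ _ hk]
    exact h _ (by simp)
  · rw [List.getD_eq_default _ _ hk]
    exact h _ (by simp)

theorem potential_bounds (s : GreedyState) : -100000 ≤ potential s ∧ potential s ≤ 0 := by
  cases s <;> exact getD_mem_Icc (by decide) _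

theorem stepValue_bounds (s : GreedyState) (x : ℕ) :
    -100000 ≤ stepValue s x ∧ stepValue s x ≤ 100000 := by
  have h1 := potential_bounds (s.next x)
  have h2 := opens_le_one s x
  unfold stepValue
  omega

/-- `7!` times the truncated sum of the lower deviations. -/
def lowerSum (s : GreedyState) : ℤ :=
  ∑ x ∈ Finset.range 8, (5040 / x.factorial : ℕ) * (stepValue s x + 100000)

/-- `7!` times the truncated sum of the upper deviations. -/
def upperSum (s : GreedyState) : ℤ :=
  ∑ x ∈ Finset.range 8, (5040 / x.factorial : ℕ) * (100000 - stepValue s x)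

/-- The two one-step inequalities, with numerical bounds for `exp (-1)`. -/
def StepBounds (s : GreedyState) : Prop :=
  5040 * 10000000000 * (29523 + 100000 + potential s) ≤ 3678794411 * lowerSum s ∧
    5040 * 10000000000 * (100000 - 29570 - potential s) ≤ 3678794411 * upperSum s

instance (s : GreedyState) : Decidable (StepBounds s) := by unfold StepBounds; infer_instance

theorem stepBounds_congr {s t : GreedyState} (hp : potential s = potential t)
    (h : ∀ x < 8, s.opens x = t.opens x ∧ s.next x = t.next x) (ht : StepBounds t) :
    StepBounds s := by
  have hv : ∀ x ∈ Finset.range 8, stepValue s x = stepValue t x := fun x hx => by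
    obtain ⟨h1, h2⟩ := h x (Finset.mem_range.1 hx)
    rw [stepValue, stepValue, h1, h2]
  have h1 : lowerSum s = lowerSum t :=
    Finset.sum_congr rfl fun x hx => by rw [hv x hx]
  have h2 : upperSum s = upperSum t :=
    Finset.sum_congr rfl fun x hx => by rw [hv x hx]
  rwa [StepBounds, hp, h1, h2]

theorem stepBounds_desc : ∀ m < 15, StepBounds (desc m) := by decide

theorem stepBounds_asc : ∀ S < 9, StepBounds (asc S) := by decide

/-- Only `x < 8` is read, so large states coincide: `asc S` descends at once for `S ≥ 8`, and for `m
≥ 14` one has `min (m - x) x = x`. -/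
theorem stepBounds (s : GreedyState) : StepBounds s := by
  cases s with
  | asc S =>
    rcases lt_or_ge S 9 with h | h
    · exact stepBounds_asc S h
    · refine stepBounds_congr (t := asc 8) ?_ (fun x hx => ⟨rfl, ?_⟩) (stepBounds_asc 8 (by norm_num))
      · simp only [potential]
        rw [List.getD_eq_default _ _ (by simp; omega), List.getD_eq_default _ _ (by simp)]
      · simp only [next]
        rw [if_neg (by omega), if_neg (by omega)]
  | desc m =>
    rcases lt_or_ge m 15 with h | h
    · exact stepBounds_desc m h
    · refine stepBounds_congr (t := desc 14) ?_ (fun x hx => ⟨?_, ?_⟩) (stepBounds_desc 14 (by norm_num))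
      · simp only [potential]
        rw [List.getD_eq_default _ _ (by simp; omega), List.getD_eq_default _ _ (by simp)]
      · simp only [opens]
        rw [if_pos (by omega), if_pos (by omega)]
      · simp only [next]
        rw [if_pos (by omega), if_pos (by omega), min_eq_right (by omega),
          min_eq_right (by omega)]

/-- The relative value of a state. -/
noncomputable def value (s : GreedyState) : ℝ := (potential s : ℝ) / 100000

theorem value_bounds (s : GreedyState) : -1 ≤ value s ∧ value s ≤ 0 := by
  obtain ⟨h1, h2⟩ := potential_bounds s
  have h1' : (-100000 : ℝ) ≤ potential s := by exact_mod_cast h1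
  have h2' : (potential s : ℝ) ≤ 0 := by exact_mod_cast h2
  unfold value
  constructor <;> linarith

theorem exp_neg_one_bound : (0.3678794411 : ℝ) ≤ Real.exp (-1) := by
  have := Real.exp_neg_one_gt_d9
  linarith

theorem opens_add_value (s : GreedyState) (x : ℕ) :
    (s.opens x : ℝ) + value (s.next x) = (stepValue s x : ℝ) / 100000 := by
  simp only [stepValue, value]
  push_cast
  ring

theorem abs_opens_add_value_le (s : GreedyState) (x : ℕ) :
    |(s.opens x : ℝ) + value (s.next x)| ≤ 1 := by
  obtain ⟨h1, h2⟩ := stepValue_bounds s x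
  have h1' : (-100000 : ℝ) ≤ stepValue s x := by exact_mod_cast h1
  have h2' : (stepValue s x : ℝ) ≤ 100000 := by exact_mod_cast h2
  rw [opens_add_value, abs_le]
  constructor <;> linarith

theorem integrable_opens_add_value (s : GreedyState) :
    Integrable (fun x => (s.opens x : ℝ) + value (s.next x)) (poissonMeasure 1) :=
  integrable_of_abs_le 1 (abs_opens_add_value_le s)

theorem le_integral_step (s : GreedyState) :
    0.29523 + value s ≤ ∫ x, ((s.opens x : ℝ) + value (s.next x)) ∂(poissonMeasure 1) := by
  refine le_trans ?_ (le_integral_poissonMeasure_one (integrable_opens_add_value s)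
    (fun x => (abs_le.1 (abs_opens_add_value_le s x)).1) 8)
  have hs : ∑ x ∈ Finset.range 8, ((s.opens x : ℝ) + value (s.next x) - -1) /
      (x.factorial : ℝ) = (lowerSum s : ℝ) / 504000000 := by
    simp only [opens_add_value]
    simp [lowerSum, Finset.sum_range_succ, Nat.factorial]
    ring
  have h := (stepBounds s).1
  have h' : (5040 * 10000000000 * (29523 + 100000 + potential s) : ℝ) ≤
    3678794411 * lowerSum s := by exact_mod_cast h
  have h0 : (0 : ℝ) ≤ lowerSum s := by
    have : 0 ≤ lowerSum s := Finset.sum_nonneg fun x _ =>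
      mul_nonneg (by positivity) (by linarith [(stepValue_bounds s x).1])
    exact_mod_cast this
  have h1 := mul_le_mul_of_nonneg_right exp_neg_one_bound h0
  rw [hs, value]
  linarith

theorem integral_step_le (s : GreedyState) :
    ∫ x, ((s.opens x : ℝ) + value (s.next x)) ∂(poissonMeasure 1) ≤ 0.2957 + value s := by
  have key := le_integral_poissonMeasure_one (integrable_opens_add_value s).neg
    (fun x => neg_le_neg (abs_le.1 (abs_opens_add_value_le s x)).2) 8
  have hs : ∑ x ∈ Finset.range 8, ((-fun x => (s.opens x : ℝ) + value (s.next x)) x - -1) /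
      (x.factorial : ℝ) = (upperSum s : ℝ) / 504000000 := by
    simp only [Pi.neg_apply, opens_add_value]
    simp [upperSum, Finset.sum_range_succ, Nat.factorial]
    ring
  have h := (stepBounds s).2
  have h' : (5040 * 10000000000 * (100000 - 29570 - potential s) : ℝ) ≤
    3678794411 * upperSum s := by exact_mod_cast h
  have h0 : (0 : ℝ) ≤ upperSum s := by
    have : 0 ≤ upperSum s := Finset.sum_nonneg fun x _ =>
      mul_nonneg (by positivity) (by linarith [(stepValue_bounds s x).2])
    exact_mod_cast this
  have h1 := mul_le_mul_of_nonneg_right exp_neg_one_bound h0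
  rw [hs, integral_neg'] at key
  rw [value]
  linarith

theorem integrable_opens_add_expectedCount (n : ℕ) (s : GreedyState) :
    Integrable (fun x => (s.opens x : ℝ) + expectedCount n (s.next x)) (poissonMeasure 1) := by
  refine integrable_of_abs_le (1 + n : ℝ) fun x => (abs_add_le _ _).trans (add_le_add ?_ ?_)
  · rw [abs_of_nonneg (by positivity)]
    exact_mod_cast opens_le_one s x
  · exact abs_expectedCount_le n _

/-! ### Linear bounds by induction -/

theorem le_expectedCount (n : ℕ) (s : GreedyState) :
    0.29523 * n + value s ≤ expectedCount n s := by
  induction n generalizing s with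
  | zero => simpa [expectedCount_zero] using (value_bounds s).2
  | succ n ih =>
    calc (0.29523 : ℝ) * (n + 1 : ℕ) + value s
        ≤ 0.29523 * n + ∫ x, ((s.opens x : ℝ) + value (s.next x)) ∂(poissonMeasure 1) := by
          have := le_integral_step s
          push_cast
          linarith
      _ = ∫ x, (0.29523 * n + ((s.opens x : ℝ) + value (s.next x))) ∂(poissonMeasure 1) := by
          rw [integral_add (integrable_const _) (integrable_opens_add_value s)]
          simp
      _ ≤ ∫ x, ((s.opens x : ℝ) + expectedCount n (s.next x)) ∂(poissonMeasure 1) := by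
          refine integral_mono ((integrable_const _).add (integrable_opens_add_value s))
            (integrable_opens_add_expectedCount n s) fun x => ?_
          have := ih (s.next x)
          simp only
          linarith
      _ = expectedCount (n + 1) s := (expectedCount_succ n s).symm

/-- The extra `1` covers `n = 0`, as `value s ≥ -1`. -/
theorem expectedCount_le (n : ℕ) (s : GreedyState) :
    expectedCount n s ≤ 0.2957 * n + 1 + value s := by
  induction n generalizing s with
  | zero =>
    have := (value_bounds s).1
    rw [expectedCount_zero]
    push_cast
    linarith
  | succ n ih =>
    calc expectedCount (n + 1) s
        = ∫ x, ((s.opens x : ℝ) + expectedCount n (s.next x)) ∂(poissonMeasure 1) :=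
          expectedCount_succ n s
      _ ≤ ∫ x, (0.2957 * n + 1 + ((s.opens x : ℝ) + value (s.next x))) ∂(poissonMeasure 1) := by
          refine integral_mono (integrable_opens_add_expectedCount n s)
            ((integrable_const _).add (integrable_opens_add_value s)) fun x => ?_
          have := ih (s.next x)
          simp only
          linarith
      _ = 0.2957 * n + 1 + ∫ x, ((s.opens x : ℝ) + value (s.next x)) ∂(poissonMeasure 1) := by
          rw [integral_add (integrable_const _) (integrable_opens_add_value s)]
          simp
      _ ≤ (0.2957 : ℝ) * (n + 1 : ℕ) + 1 + value s := by
          have := integral_step_le s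
          push_cast
          linarith

theorem expectedPathAcquisition_eq (n : ℕ) :
    expectedPathAcquisition n = expectedCount n (desc 0) := by
  simp only [expectedPathAcquisition, expectedCount, acquisitionNumber_pathGraph]

end Acquisition

theorem mainTheorem6 :
    (∀ n : ℕ, 1 ≤ n → (0.29523 : ℝ) * (n : ℝ) ≤ Acquisition.expectedPathAcquisition n) ∧
    (∃ N : ℕ, ∀ n : ℕ, N ≤ n →
      Acquisition.expectedPathAcquisition n ≤ (0.29576 : ℝ) * (n : ℝ)) := by
  have hv : Acquisition.value (.desc 0) = 0 := by
    simp [Acquisition.value, Acquisition.potential]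
  constructor
  · intro n _
    have := Acquisition.le_expectedCount n (.desc 0)
    rw [Acquisition.expectedPathAcquisition_eq]
    linarith
  -- The slack `0.00006 * n` exceeds the additive `1` here.
  · refine ⟨20000, fun n hn => ?_⟩
    have := Acquisition.expectedCount_le n (.desc 0)
    have hn' : (20000 : ℝ) ≤ n := by exact_mod_cast hn
    rw [Acquisition.expectedPathAcquisition_eq]
    linarith
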